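/- For a finite simple graph $G$, let $G\times K_2$ denote the bunkbed graph, i.e. the Cartesian product of $G$ with the complete graph on the vertex set $\{0,1\}$; its vertices $(u,i)$ are written $u_i$, and its edges are $u_iv_i$ for $uv\in E(G)$, $i\in\{0,1\}$, and $u_0u_1$ for $u\in V(G)$. For vertices $x,y$ of a graph, let $\mathscr{S}(x,y)$ be the set of self-avoiding walks (of any length) from $x$ to $y$, i.e. walks along edges in which no vertex is repeated. Consider $K_n\times K_2$ with $n\ge 2$, where $K_n$ is the complete graph on $n$ vertices. Then for all distinct vertices $u,v\in V(K_n)$: 1. if $n=2$, then $|\mathscr{S}(u_0,v_0)|=|\mathscr{S}(u_0,v_1)|$; 2. if $n\in\{3,4,5\}$, then $|\mathscr{S}(u_0,v_0)|<|\mathscr{S}(u_0,v_1)|$; 3. if $n$ is sufficiently large, then $|\mathscr{S}(u_0,v_0)|<|\mathscr{S}(u_0,v_1)|$; that is, there is an $N$ such that this inequality holds for every $n\ge N$ and all distinct $u,v\in V(K_n)$. -/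

import Mathlib

/-- The bunkbed graph `G × K₂` with base `G`: the Cartesian (box) product of `G` with the complete
graph on the two vertices `0, 1`. The vertex `u_i` is the pair `(u, i)`. -/
def bunkbed {V : Type*} (G : SimpleGraph V) : SimpleGraph (V × Fin 2) :=
  G.boxProd (SimpleGraph.completeGraph (Fin 2))

/-- The set `𝒮(x, y)` of self-avoiding walks (of any length) from `x` to `y`: walks in `G` whose
vertices are pairwise distinct. -/
def selfAvoidingWalks {V : Type*} (G : SimpleGraph V) (x y : V) : Set (G.Walk x y) :=
  {w | w.IsPath}

/-- In a finite graph, `𝒮(x, y)` is finite, so that `Set.ncard` is its cardinality. -/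
theorem selfAvoidingWalks_finite {V : Type*} [Finite V] (G : SimpleGraph V) (x y : V) :
    (selfAvoidingWalks G x y).Finite := by
  classical
  have := Fintype.ofFinite V
  exact Set.finite_coe_iff.mp (inferInstanceAs (Finite (G.Path x y)))

/-! For n ≤ 5 the walks are counted exactly, by a depth-first search proved correct and evaluated in
the kernel. For large n, let F = `arr 1 (n - 2)` be the number of repetition-free lists over n - 2
elements, roughly e·(n-2)!. Both counts have order n·F², with different constants.

Upper bound (`ncard_pathTails_le`): a walk from u_0 to v_0 with 2r vertical edges is a path from u
to v at level 0, r of whose steps are replaced by excursions to level 1. There are F such paths and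
at most C(n-1, r) choices of steps. The 2r feet of the excursions are distinct, so their interiors
are r disjoint lists over n - 2r vertices. The term r = 0 is only F; the term r = s + 1 is at most
(n-1)F²/((s+1)! s!) by `choose_mul_arr_mul_factorial_le`, and the sum of 1/((s+1)! s!) stays below
5/3.

Lower bound (`le_ncard_pathTails`): the walks from u_0 to v_1 with one vertical edge, and those with
three, each contribute about nF². Hence there are about 2nF² of them, and 2 > 5/3. -/

/-! ### Self-avoiding walks as vertex lists -/

/-- The vertex lists, without the initial vertex, of the self-avoiding walks from `x` to `y`. -/
def pathTails {V : Type*} (G : SimpleGraph V) (x y : V) : Set (List V) :=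
  {l | (x :: l).IsChain G.Adj ∧ (x :: l).Nodup ∧ (x :: l).getLast? = some y}

theorem exists_walk_support_eq {V : Type*} (G : SimpleGraph V) (l : List V) :
    ∀ x y : V, (x :: l).IsChain G.Adj → (x :: l).getLast? = some y →
      ∃ w : G.Walk x y, w.support = x :: l := by
  induction l with
  | nil =>
    intro x y _ hl
    obtain rfl : x = y := by simpa using hl
    exact ⟨.nil, rfl⟩
  | cons z l ih =>
    intro x y hc hl
    rw [List.isChain_cons_cons] at hc
    rw [List.getLast?_cons_cons] at hl
    obtain ⟨w, hw⟩ := ih z y hc.2 hl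
    exact ⟨.cons hc.1 w, by rw [SimpleGraph.Walk.support_cons, hw]⟩

/-- In a simple graph a walk is determined by its support. Plain lists replace the dependent type of
walks in all the counting below. -/
theorem ncard_selfAvoidingWalks {V : Type*} (G : SimpleGraph V) (x y : V) :
    (selfAvoidingWalks G x y).ncard = (pathTails G x y).ncard := by
  refine Set.ncard_congr (fun w _ => w.support.tail) ?_ ?_ ?_
  · intro w hw
    have h : x :: w.support.tail = w.support := w.cons_tail_support
    refine ⟨h ▸ w.isChain_adj_support, h ▸ hw.support_nodup, ?_⟩
    rw [h, List.getLast?_eq_getLast_of_ne_nil w.support_ne_nil, w.getLast_support]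
  · intro w w' _ _ h
    apply SimpleGraph.Walk.ext_support
    rw [← w.cons_tail_support, ← w'.cons_tail_support, h]
  · rintro l ⟨hc, hn, hl⟩
    obtain ⟨w, hw⟩ := exists_walk_support_eq G l x y hc hl
    refine ⟨w, ?_, by rw [hw, List.tail_cons]⟩
    change w.IsPath
    rwa [SimpleGraph.Walk.isPath_def, hw]

theorem finite_pathTails {V : Type*} [Finite V] (G : SimpleGraph V) (x y : V) :
    (pathTails G x y).Finite := by
  have := Fintype.ofFinite V
  refine (List.finite_length_le V (Fintype.card V)).subset ?_
  rintro l ⟨-, hn, -⟩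
  have := hn.length_le_card
  simp only [List.length_cons] at this
  simp only [Set.mem_ofPred_eq]
  omega

theorem bunkbed_completeGraph_adj {V : Type*} (p q : V × Fin 2) :
    (bunkbed (SimpleGraph.completeGraph V)).Adj p q ↔
      (p.1 ≠ q.1 ∧ p.2 = q.2) ∨ (p.2 ≠ q.2 ∧ p.1 = q.1) := by
  simp [bunkbed, SimpleGraph.boxProd_adj, SimpleGraph.completeGraph]

/-! ### Exact counts for small n -/

/-- Depth-first count of the paths from `x` to `y` whose later vertices are all in `avail`. -/
def countPaths {V : Type*} [DecidableEq V] (adj : V → V → Bool) :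
    ℕ → List V → V → V → ℕ
  | 0, _, x, y => if x = y then 1 else 0
  | k + 1, avail, x, y => if x = y then 1 else
      ((avail.filter (adj x)).map fun z => countPaths adj k (avail.erase z) z y).sum

/-- Each step removes a vertex from `avail`, so the fuel `k` never runs out early. Since `x ∉
avail`, a walk that has reached `y` cannot return to it, which justifies stopping there with count
1. -/
theorem exists_finset_countPaths {V : Type*} [DecidableEq V] (G : SimpleGraph V)
    (adj : V → V → Bool) (hadj : ∀ x y, adj x y = true ↔ G.Adj x y) (y : V) (k : ℕ) :
    ∀ (avail : List V) (x : V), avail.length ≤ k → avail.Nodup → x ∉ avail →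
    ∃ T : Finset (List V), (∀ l, l ∈ T ↔ (x :: l).IsChain G.Adj ∧ l.Nodup ∧
      (∀ z ∈ l, z ∈ avail) ∧ (x :: l).getLast? = some y) ∧
      T.card = countPaths adj k avail x y := by
  induction k with
  | zero =>
    intro avail x hk _ _
    obtain rfl : avail = [] := by simpa using hk
    refine ⟨if x = y then {[]} else ∅, fun l => ?_, ?_⟩
    · rcases l with _ | ⟨z, l⟩
      · split_ifs with h <;> simp [h]
      · have : ¬ ∀ w ∈ z :: l, w ∈ ([] : List V) := fun h => by simpa using h z (by simp)
        split_ifs with h <;> simp only [this, false_and, and_false, iff_false] <;> simp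
    · simp only [countPaths]
      split_ifs <;> rfl
  | succ k ih =>
    intro avail x hk hnd hx
    by_cases hxy : x = y
    · subst hxy
      refine ⟨{[]}, fun l => ?_, by simp [countPaths]⟩
      rcases l with _ | ⟨z, l⟩
      · simp
      · simp only [Finset.mem_singleton, reduceCtorEq, false_iff]
        rintro ⟨-, -, hz, hl⟩
        rw [List.getLast?_cons_cons] at hl
        exact hx (hz x (List.mem_of_getLast? hl))
    -- The membership hypothesis sits inside the existential so that `choose` yields a total
    -- function of `z`.
    · have key : ∀ z, ∃ T : Finset (List V), z ∈ avail →
          (∀ l, l ∈ T ↔ (z :: l).IsChain G.Adj ∧ l.Nodup ∧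
            (∀ w ∈ l, w ∈ avail.erase z) ∧ (z :: l).getLast? = some y) ∧
          T.card = countPaths adj k (avail.erase z) z y := by
        intro z
        by_cases hz : z ∈ avail
        · obtain ⟨T, hT⟩ := ih (avail.erase z) z
            (by rw [List.length_erase_of_mem hz]; omega) (hnd.erase z)
            (fun h => by simp [hnd.mem_erase_iff] at h)
          exact ⟨T, fun _ => hT⟩
        · exact ⟨∅, fun h => absurd h hz⟩
      choose T hT using key
      have hnd' : (avail.filter (adj x)).Nodup := hnd.filter _
      refine ⟨(avail.filter (adj x)).toFinset.biUnion
        fun z => (T z).image (List.cons z), fun l => ?_, ?_⟩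
      · simp only [Finset.mem_biUnion, List.mem_toFinset, List.mem_filter, Finset.mem_image]
        constructor
        · rintro ⟨z, ⟨hz, hxz⟩, l', hl', rfl⟩
          rw [(hT z hz).1] at hl'
          obtain ⟨h1, h2, h3, h4⟩ := hl'
          simp only [hnd.mem_erase_iff] at h3
          refine ⟨List.isChain_cons_cons.2 ⟨(hadj _ _).1 hxz, h1⟩,
            List.nodup_cons.2 ⟨fun h => (h3 z h).1 rfl, h2⟩, ?_, ?_⟩
          · intro w hw
            rcases List.mem_cons.1 hw with rfl | hw
            · exact hz
            · exact (h3 w hw).2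
          · rwa [List.getLast?_cons_cons]
        · rintro ⟨h1, h2, h3, h4⟩
          rcases l with _ | ⟨z, l⟩
          · simp at h4; exact absurd h4 hxy
          · have hz := h3 z (by simp)
            refine ⟨z, ⟨hz, (hadj _ _).2 (List.isChain_cons_cons.1 h1).1⟩, l, ?_, rfl⟩
            rw [(hT z hz).1]
            refine ⟨(List.isChain_cons_cons.1 h1).2, (List.nodup_cons.1 h2).2, ?_, ?_⟩
            · intro w hw
              rw [hnd.mem_erase_iff]
              exact ⟨fun h => (List.nodup_cons.1 h2).1 (h ▸ hw), h3 w (by simp [hw])⟩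
            · rwa [List.getLast?_cons_cons] at h4
      · rw [Finset.card_biUnion]
        · rw [countPaths, if_neg hxy, ← List.sum_toFinset _ hnd']
          refine Finset.sum_congr rfl fun z hz => ?_
          rw [Finset.card_image_of_injective _ (List.cons_injective)]
          exact (hT z (by simp at hz; exact hz.1)).2
        · intro z _ z' _ hzz'
          rw [Function.onFun, Finset.disjoint_left]
          intro l hl hl'
          simp only [Finset.mem_image] at hl hl'
          obtain ⟨a, -, rfl⟩ := hl
          obtain ⟨b, -, h⟩ := hl'
          exact hzz' (List.cons.inj h).1.symm

/-- Adjacency in the bunkbed graph of a complete graph, as a Boolean function. -/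
def bunkbedAdj {n : ℕ} (p q : Fin n × Fin 2) : Bool :=
  (p.1 == q.1) != (p.2 == q.2)

/-- The number of self-avoiding walks in the bunkbed graph of `Kₙ`, by depth-first search. -/
def bunkbedCount (n : ℕ) (x y : Fin n × Fin 2) : ℕ :=
  countPaths bunkbedAdj (2 * n) ((List.finRange n ×ˢ List.finRange 2).erase x) x y

theorem ncard_selfAvoidingWalks_eq_bunkbedCount (n : ℕ) (x y : Fin n × Fin 2) :
    (selfAvoidingWalks (bunkbed (SimpleGraph.completeGraph (Fin n))) x y).ncard =
      bunkbedCount n x y := by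
  have hnd : (List.finRange n ×ˢ List.finRange 2).Nodup :=
    (List.nodup_finRange n).product (List.nodup_finRange 2)
  obtain ⟨T, hT, hc⟩ := exists_finset_countPaths
    (bunkbed (SimpleGraph.completeGraph (Fin n))) bunkbedAdj
    (fun p q => by
      rw [bunkbed_completeGraph_adj, bunkbedAdj]
      by_cases h1 : p.1 = q.1 <;> by_cases h2 : p.2 = q.2 <;> simp [h1, h2])
    y (2 * n) ((List.finRange n ×ˢ List.finRange 2).erase x) x
    (by
      refine (List.length_erase_le).trans ?_
      rw [List.length_product]
      simp [mul_comm])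
    (hnd.erase x) (fun h => by simp [hnd.mem_erase_iff] at h)
  rw [ncard_selfAvoidingWalks, bunkbedCount, ← hc, ← Set.ncard_coe_finset]
  congr 1
  ext l
  rw [Finset.mem_coe, hT]
  simp only [pathTails, Set.mem_ofPred_eq, List.nodup_cons, hnd.mem_erase_iff]
  constructor
  · rintro ⟨h1, ⟨h2, h3⟩, h4⟩
    refine ⟨h1, h3, fun z hz => ⟨fun h => h2 (h ▸ hz),
      List.pair_mem_product.2 ⟨List.mem_finRange z.1, List.mem_finRange z.2⟩⟩, h4⟩
  · rintro ⟨h1, h2, h3, h4⟩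
    exact ⟨h1, ⟨fun h => (h3 x h).1 rfl, h2⟩, h4⟩

theorem bunkbedCount_two : ∀ u v : Fin 2, u ≠ v →
    bunkbedCount 2 (u, 0) (v, 0) = bunkbedCount 2 (u, 0) (v, 1) := by
  decide +kernel

theorem bunkbedCount_three : ∀ u v : Fin 3, u ≠ v →
    bunkbedCount 3 (u, 0) (v, 0) < bunkbedCount 3 (u, 0) (v, 1) := by
  decide +kernel

theorem bunkbedCount_four : ∀ u v : Fin 4, u ≠ v →
    bunkbedCount 4 (u, 0) (v, 0) < bunkbedCount 4 (u, 0) (v, 1) := by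
  decide +kernel

theorem bunkbedCount_five : ∀ u v : Fin 5, u ≠ v →
    bunkbedCount 5 (u, 0) (v, 0) < bunkbedCount 5 (u, 0) (v, 1) := by
  decide +kernel

/-! ### Counting tuples of disjoint lists -/

/-- `arr t m` is the number of `t`-tuples of lists, without repetitions inside or among them,
over a set of `m` elements. -/
def arr : ℕ → ℕ → ℕ
  | 0, _ => 1
  | _ + 1, 0 => 1
  | t + 1, m + 1 => arr t (m + 1) + (m + 1) * arr (t + 1) m

theorem arr_one_zero : arr 1 0 = 1 := by simp [arr]

theorem arr_one_succ (m : ℕ) : arr 1 (m + 1) = 1 + (m + 1) * arr 1 m := by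
  simp [arr]

/-- A pair of lists is one list with a cut point, so a list of length j counts j + 1 times. The
lower bound needs this value to leading order. -/
theorem arr_two (m : ℕ) : arr 2 m = m * arr 1 m + 1 := by
  induction m with
  | zero => simp [arr]
  | succ m ih =>
    have h : arr 2 (m + 1) = arr 1 (m + 1) + (m + 1) * arr 2 m := by rw [arr]
    rw [h, ih, arr_one_succ]
    ring

/-- Concatenating t + 1 lists gives one list with t cut points; its length is at most m, which
leaves at most C(m+t, t) positions. The induction is Pascal's rule. -/
theorem arr_succ_le_choose_mul (t : ℕ) : ∀ m, arr (t + 1) m ≤ (m + t).choose t * arr 1 m := by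
  induction t with
  | zero => simp
  | succ t ih =>
    intro m
    induction m with
    | zero => simp [arr]
    | succ m ihm =>
      have h : arr (t + 1 + 1) (m + 1) = arr (t + 1) (m + 1) + (m + 1) * arr (t + 1 + 1) m := by
        rw [arr]
      have h1 := ih (m + 1)
      have h2 : (m + 1) * arr (t + 1 + 1) m ≤ (m + (t + 1)).choose (t + 1) * arr 1 (m + 1) := by
        rw [arr_one_succ]
        nlinarith [Nat.mul_le_mul_left (m + 1) ihm]
      have h3 : (m + 1 + (t + 1)).choose (t + 1) =
          (m + 1 + t).choose t + (m + (t + 1)).choose (t + 1) := by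
        rw [show m + 1 + (t + 1) = (m + 1 + t) + 1 by ring, Nat.choose_succ_succ,
          show m + (t + 1) = m + 1 + t by ring]
      rw [h, h3]
      exact (add_le_add h1 h2).trans_eq (add_mul _ _ _).symm

/-- `t`-tuples of lists over `S` without repetitions inside or among them. -/
def IsArrangement {V : Type*} (t : ℕ) (S : Finset V) (g : List (List V)) : Prop :=
  g.length = t ∧ g.flatten.Nodup ∧ ∀ x ∈ g.flatten, x ∈ S

/-- This follows the recursion of `arr`: the first list is empty and is dropped, or its head x is
removed and the rest lives over `S.erase x`. -/
theorem exists_finset_arrangements {V : Type*} [DecidableEq V] (t : ℕ) :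
    ∀ (m : ℕ) (S : Finset V), S.card = m →
      ∃ T : Finset (List (List V)), (∀ g, g ∈ T ↔ IsArrangement t S g) ∧ T.card = arr t m := by
  induction t with
  | zero =>
    intro m S _
    refine ⟨{[]}, fun g => ?_, by simp [arr]⟩
    rw [Finset.mem_singleton, IsArrangement, List.length_eq_zero_iff]
    constructor
    · rintro rfl; simp
    · exact fun h => h.1
  | succ t ih =>
    have split : ∀ (S : Finset V) (g : List (List V)), IsArrangement (t + 1) S g ↔
        (∃ g', IsArrangement t S g' ∧ [] :: g' = g) ∨
        ∃ x ∈ S, ∃ g', IsArrangement (t + 1) (S.erase x) g' ∧ g'.modifyHead (List.cons x) = g := by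
      intro S g
      constructor
      · rintro ⟨h1, h2, h3⟩
        rcases g with _ | ⟨_ | ⟨x, l⟩, g⟩
        · simp at h1
        · exact Or.inl ⟨g, ⟨by simpa using h1, by simpa using h2, by simpa using h3⟩, rfl⟩
        · rw [List.flatten_cons, List.cons_append] at h2 h3
          refine Or.inr ⟨x, h3 x (by simp), l :: g, ⟨by simpa using h1, ?_, ?_⟩, rfl⟩
          · rw [List.flatten_cons]; exact (List.nodup_cons.1 h2).2
          · intro y hy
            rw [List.flatten_cons] at hy
            exact Finset.mem_erase.2 ⟨fun h => (List.nodup_cons.1 h2).1 (h ▸ hy),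
              h3 y (List.mem_cons_of_mem _ hy)⟩
      · rintro (⟨g', ⟨h1, h2, h3⟩, rfl⟩ | ⟨x, hx, g', ⟨h1, h2, h3⟩, rfl⟩)
        · exact ⟨by simpa using h1, by simpa using h2, by simpa using h3⟩
        · rcases g' with _ | ⟨l, g'⟩
          · simp at h1
          · rw [List.flatten_cons] at h2 h3
            refine ⟨by simpa using h1, ?_, ?_⟩
            · rw [List.modifyHead_cons, List.flatten_cons, List.cons_append]
              exact List.nodup_cons.2 ⟨fun h => by simpa using h3 x h, h2⟩
            · rw [List.modifyHead_cons, List.flatten_cons, List.cons_append]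
              intro y hy
              rcases List.mem_cons.1 hy with rfl | hy
              · exact hx
              · exact Finset.mem_of_mem_erase (h3 y hy)
    intro m
    induction m with
    | zero =>
      intro S hS
      obtain rfl := Finset.card_eq_zero.1 hS
      obtain ⟨T, hT, hc⟩ := ih 0 ∅ rfl
      refine ⟨T.image (List.cons []), fun g => ?_, ?_⟩
      · rw [split, Finset.mem_image]
        simp [hT]
      · rw [Finset.card_image_of_injective _ List.cons_injective, hc]
        cases t <;> simp [arr]
    | succ m ihm =>
      intro S hS
      obtain ⟨T, hT, hc⟩ := ih (m + 1) S hS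
      have key : ∀ x, ∃ U : Finset (List (List V)), x ∈ S →
          (∀ g, g ∈ U ↔ IsArrangement (t + 1) (S.erase x) g) ∧ U.card = arr (t + 1) m := by
        intro x
        by_cases hx : x ∈ S
        · obtain ⟨U, hU⟩ := ihm (S.erase x) (by rw [Finset.card_erase_of_mem hx, hS]; rfl)
          exact ⟨U, fun _ => hU⟩
        · exact ⟨∅, fun h => absurd h hx⟩
      choose U hU using key
      refine ⟨T.image (List.cons []) ∪
        S.biUnion fun x => (U x).image (List.modifyHead (List.cons x)), fun g => ?_, ?_⟩
      · rw [split, Finset.mem_union, Finset.mem_image, Finset.mem_biUnion]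
        refine or_congr (by simp [hT]) (exists_congr fun x => and_congr_right fun hx => ?_)
        simp [(hU x hx).1]
      -- `List.modifyHead` fixes the empty tuple, so injectivity and disjointness rely on tuples
      -- being nonempty.
      · have ne : ∀ x ∈ S, ∀ g ∈ U x, ∃ l g', g = l :: g' := by
          intro x hx g hg
          have := (((hU x hx).1 g).1 hg).1
          rcases g with _ | ⟨l, g'⟩
          · simp at this
          · exact ⟨l, g', rfl⟩
        rw [Finset.card_union_of_disjoint, Finset.card_image_of_injective _ List.cons_injective,
          hc, Finset.card_biUnion, arr]
        · congr 1
          rw [← hS, ← smul_eq_mul, ← Finset.sum_const]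
          refine Finset.sum_congr rfl fun x hx => ?_
          rw [Finset.card_image_of_injOn, (hU x hx).2]
          intro g hg g' hg' h
          obtain ⟨l, a, rfl⟩ := ne x hx g hg
          obtain ⟨l', a', rfl⟩ := ne x hx g' hg'
          simpa using h
        · intro x hx y hy hxy
          rw [Function.onFun, Finset.disjoint_left]
          intro g hg hg'
          simp only [Finset.mem_image] at hg hg'
          obtain ⟨a, ha, rfl⟩ := hg
          obtain ⟨b, hb, h⟩ := hg'
          obtain ⟨l, a, rfl⟩ := ne x hx a ha
          obtain ⟨l', b, rfl⟩ := ne y hy b hb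
          simp only [List.modifyHead_cons, List.cons.injEq] at h
          exact hxy h.1.1.symm
        · rw [Finset.disjoint_left]
          intro g hg hg'
          simp only [Finset.mem_image, Finset.mem_biUnion] at hg hg'
          obtain ⟨a, -, rfl⟩ := hg
          obtain ⟨x, hx, b, hb, h⟩ := hg'
          obtain ⟨l', b, rfl⟩ := ne x hx b hb
          simp at h

/-! ### Decomposition of a walk into level 0 and excursions -/

/-- The first components of the entries of `l` at level `i`, in order. -/
def level {V : Type*} (i : Fin 2) (l : List (V × Fin 2)) : List V :=
  l.filterMap fun p => if p.2 = i then some p.1 else none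

section level

variable {V : Type*} (i : Fin 2)

@[simp] theorem level_nil : level i ([] : List (V × Fin 2)) = [] := rfl

@[simp] theorem level_append (l l' : List (V × Fin 2)) :
    level i (l ++ l') = level i l ++ level i l' := List.filterMap_append

@[simp] theorem level_cons (x : V) (j : Fin 2) (l : List (V × Fin 2)) :
    level i ((x, j) :: l) = if j = i then x :: level i l else level i l := by
  by_cases h : j = i <;> simp [level, h]

@[simp] theorem level_map (l : List V) (j : Fin 2) :
    level i (l.map (·, j)) = if j = i then l else [] := by
  induction l with
  | nil => simp
  | cons x l ih => by_cases h : j = i <;> simp_all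

theorem mem_level {x : V} {l : List (V × Fin 2)} : x ∈ level i l ↔ (x, i) ∈ l := by
  simp only [level, List.mem_filterMap, Option.ite_none_right_eq_some, Option.some.injEq]
  constructor
  · rintro ⟨⟨a, j⟩, h, rfl, rfl⟩; exact h
  · exact fun h => ⟨_, h, rfl, rfl⟩

/-- Entries at different levels never coincide, so the two levels carry independent constraints;
this is what makes the counts products. -/
theorem nodup_iff_level {l : List (V × Fin 2)} :
    l.Nodup ↔ (level 0 l).Nodup ∧ (level 1 l).Nodup := by
  induction l with
  | nil => simp
  | cons p l ih =>
    obtain ⟨x, j⟩ := p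
    rw [List.nodup_cons, ih, ← mem_level]
    fin_cases j <;> simp <;> tauto

end level

/-- The list of vertices that is made of the marked list `d` of vertices at level `0`, where the
mark `true` means that the next list of `g` is traversed at level `1` before the walk comes back
at the next vertex of `d`. -/
def weave {V : Type*} : List (V × Bool) → List (List V) → List (V × Fin 2)
  | [], _ => []
  | [p], _ => [(p.1, 0)]
  | (x, false) :: q :: d, g => (x, 0) :: weave (q :: d) g
  | (x, true) :: q :: d, g =>
    (x, 0) :: (x, 1) :: (g.headI.map (·, 1) ++ (q.1, 1) :: weave (q :: d) g.tail)

/-- The number of marks in a marked list. -/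
def marks {V : Type*} (d : List (V × Bool)) : ℕ := d.countP (·.2)

@[simp] theorem marks_nil {V : Type*} : marks ([] : List (V × Bool)) = 0 := rfl

@[simp] theorem marks_cons {V : Type*} (x : V) (b : Bool) (d : List (V × Bool)) :
    marks ((x, b) :: d) = marks d + b.toNat := by
  cases b <;> simp [marks]

/-- The base vertices of the vertical edges in `weave d g`. -/
def pillars {V : Type*} : List (V × Bool) → List V
  | [] => []
  | [_] => []
  | (_, false) :: q :: d => pillars (q :: d)
  | (x, true) :: q :: d => x :: q.1 :: pillars (q :: d)

section weave

variable {V : Type*}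

theorem length_pillars : ∀ d : List (V × Bool), (∀ p, d.getLast? = some p → p.2 = false) →
    (pillars d).length = 2 * marks d
  | [], _ => rfl
  | [(x, b)], h => by
    obtain rfl : b = false := h (x, b) rfl
    rfl
  | (x, false) :: q :: d, h => by
    rw [pillars, length_pillars (q :: d) fun p hp => h p (by rwa [List.getLast?_cons_cons])]
    simp
  | (x, true) :: q :: d, h => by
    simp only [pillars, List.length_cons]
    rw [length_pillars (q :: d) fun p hp => h p (by rwa [List.getLast?_cons_cons]),
      marks_cons (b := true), Bool.toNat_true]
    ring

theorem level_zero_weave : ∀ (d : List (V × Bool)) (g : List (List V)),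
    level 0 (weave d g) = d.map Prod.fst
  | [], _ => rfl
  | [p], _ => rfl
  | (x, false) :: q :: d, g => by
    simp [weave, level_zero_weave (q :: d)]
  | (x, true) :: q :: d, g => by
    simp [weave, level_zero_weave (q :: d)]

/-- The last mark has to be `false` because `weave` ignores it while `marks` counts it. -/
theorem level_one_weave : ∀ (d : List (V × Bool)) (g : List (List V)),
    (∀ p, d.getLast? = some p → p.2 = false) → g.length = marks d →
    (level 1 (weave d g)).Perm (pillars d ++ g.flatten)
  | [], g, _, h => by
    obtain rfl : g = [] := by simpa using h
    simp [weave, pillars]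
  | [(x, b)], g, hd, h => by
    obtain rfl : b = false := hd (x, b) rfl
    obtain rfl : g = [] := by simpa using h
    simp [weave, pillars]
  | (x, false) :: q :: d, g, hd, h => by
    have := level_one_weave (q :: d) g
      (fun p hp => hd p (by rwa [List.getLast?_cons_cons])) (by simpa using h)
    simpa [weave, pillars] using this
  | (x, true) :: q :: d, [], hd, h => by
    rw [marks_cons (b := true), Bool.toNat_true] at h
    simp at h
  | (x, true) :: q :: d, c :: g, hd, h => by
    rw [marks_cons (b := true), Bool.toNat_true] at h
    have := level_one_weave (q :: d) g
      (fun p hp => hd p (by rwa [List.getLast?_cons_cons])) (by simpa using h)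
    simp only [weave, pillars, List.headI_cons, List.tail_cons, level_cons, level_append,
      level_map, List.flatten_cons, List.cons_append, if_true, zero_ne_one, if_false]
    refine List.Perm.cons x ?_
    refine List.perm_middle.trans (List.Perm.cons q.1 ?_)
    refine (this.append_left c).trans ?_
    rw [← List.append_assoc, ← List.append_assoc]
    exact List.perm_append_comm.append_right _

end weave

/-- The two statements, for a walk at level 0 and for one in the middle of an excursion, are proved
by a common induction. In the second, `c` is the part of the level-1 run before the vertex `y` where
the walk descends; its last clause tells whether the walk descends at once. -/
theorem exists_weave_eq {V : Type*} (v : V) (l : List (V × Fin 2)) :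
    (∀ x, ((x, 0) :: l).IsChain (bunkbed (SimpleGraph.completeGraph V)).Adj →
      ((x, 0) :: l).Nodup → ((x, 0) :: l).getLast? = some (v, 0) →
      ∃ b d g, g.length = marks ((x, b) :: d) ∧
        ((x, b) :: d).getLast? = some (v, false) ∧ weave ((x, b) :: d) g = (x, 0) :: l) ∧
    (∀ x, ((x, 1) :: l).IsChain (bunkbed (SimpleGraph.completeGraph V)).Adj →
      ((x, 1) :: l).Nodup → ((x, 1) :: l).getLast? = some (v, 0) →
      ∃ c y b d g, g.length = marks ((y, b) :: d) ∧
        ((y, b) :: d).getLast? = some (v, false) ∧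
        c.map (·, 1) ++ (y, 1) :: weave ((y, b) :: d) g = (x, 1) :: l ∧
        (c = [] ∧ y = x ∨ ∃ c', c = x :: c')) := by
  induction l with
  | nil =>
    refine ⟨fun x _ _ h => ?_, fun x _ _ h => by simp at h⟩
    obtain rfl : x = v := by simpa using h
    exact ⟨false, [], [], rfl, rfl, rfl⟩
  | cons p l ih =>
    obtain ⟨z, j⟩ := p
    constructor
    · intro x hc hn hl
      rw [List.isChain_cons_cons, bunkbed_completeGraph_adj] at hc
      rw [List.getLast?_cons_cons] at hl
      obtain ⟨hxz, hc⟩ := hc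
      have hn' := (List.nodup_cons.1 hn).2
      obtain rfl | rfl : j = 0 ∨ j = 1 := by omega
      · obtain ⟨b, d, g, h1, h2, h3⟩ := ih.1 z hc hn' hl
        refine ⟨false, (z, b) :: d, g, ?_, ?_, ?_⟩
        · rw [h1, marks_cons (b := false), Bool.toNat_false, add_zero]
        · rwa [List.getLast?_cons_cons]
        · rw [weave, h3]
      · obtain ⟨c, y, b, d, g, h1, h2, h3, h4⟩ := ih.2 z hc hn' hl
        have hzx : x = z := by simpa using hxz
        subst hzx
        obtain ⟨rfl, rfl⟩ | ⟨c, rfl⟩ := h4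
        -- Descending immediately after ascending would revisit the same vertex at level 0; hence
        -- the two feet of an excursion differ.
        · exfalso
          have : (y, 0) ∈ (y, 1) :: l := by
            rw [← h3]
            rcases d with _ | ⟨q, d⟩ <;> cases b <;> simp [weave]
          exact (List.nodup_cons.1 hn).1 this
        · refine ⟨true, (y, b) :: d, c :: g, ?_, ?_, ?_⟩
          · rw [List.length_cons, h1, marks_cons (b := true), Bool.toNat_true]
          · rwa [List.getLast?_cons_cons]
          · rw [weave, List.headI_cons, List.tail_cons, ← h3]
            simp
    · intro x hc hn hl
      rw [List.isChain_cons_cons, bunkbed_completeGraph_adj] at hc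
      rw [List.getLast?_cons_cons] at hl
      obtain ⟨hxz, hc⟩ := hc
      have hn' := (List.nodup_cons.1 hn).2
      obtain rfl | rfl : j = 0 ∨ j = 1 := by omega
      · obtain ⟨b, d, g, h1, h2, h3⟩ := ih.1 z hc hn' hl
        have hzx : x = z := by simpa using hxz
        subst hzx
        exact ⟨[], x, b, d, g, h1, h2, by simp [h3], Or.inl ⟨rfl, rfl⟩⟩
      · obtain ⟨c, y, b, d, g, h1, h2, h3, -⟩ := ih.2 z hc hn' hl
        exact ⟨x :: c, y, b, d, g, h1, h2, by simp [h3], Or.inr ⟨c, rfl⟩⟩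

/-! ### Upper bound for walks from u_0 to v_0 -/

/-- Marked lists without repeated vertices from `x` to the unmarked vertex `v`, with inner vertices
in `S` and with `r` marks. -/
structure IsMarked {V : Type*} (v : V) (S : Finset V) (x : V) (r : ℕ) (d : List (V × Bool)) :
    Prop where
  head : ∃ b e, d = (x, b) :: e
  nodup : (d.map Prod.fst).Nodup
  mem : ∀ y ∈ (d.map Prod.fst).tail, y ∈ S ∨ y = v
  last : d.getLast? = some (v, false)
  count : marks d = r

theorem IsMarked.cases {V : Type*} [DecidableEq V] {v : V} {S : Finset V} {x : V} {r : ℕ}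
    {d : List (V × Bool)} (h : IsMarked v S x r d) (hx : x ≠ v) :
    (∃ b : Bool, d = [(x, b), (v, false)] ∧ r = b.toNat) ∨
    ∃ y ∈ S, ∃ b e r', d = (x, b) :: e ∧ IsMarked v (S.erase y) y r' e ∧ r = r' + b.toNat := by
  obtain ⟨⟨b, e, rfl⟩, h2, h3, h4, h5⟩ := h
  rcases e with _ | ⟨⟨y, c⟩, e⟩
  · simp at h4; exact absurd h4.1 hx
  · rw [List.getLast?_cons_cons] at h4
    have hr : r = marks ((y, c) :: e) + b.toNat := by
      rw [← h5, marks_cons x b]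
    rw [List.map_cons, List.nodup_cons] at h2
    have h2' := h2.2
    rw [List.map_cons, List.nodup_cons] at h2'
    by_cases hy : y = v
    · subst hy
      rcases e with _ | ⟨q, e⟩
      · obtain rfl : c = false := by simpa using h4
        exact Or.inl ⟨b, rfl, by simpa using hr⟩
      · rw [List.getLast?_cons_cons] at h4
        exact absurd (List.mem_map_of_mem (f := Prod.fst) (List.mem_of_getLast? h4)) h2'.1
    · have hyS : y ∈ S := (h3 y (by simp)).resolve_right hy
      refine Or.inr ⟨y, hyS, b, _, _, rfl, ⟨⟨c, e, rfl⟩, h2.2, ?_, h4, rfl⟩, hr⟩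
      intro p hp
      refine (h3 p (List.mem_cons_of_mem _ hp)).imp_left fun h => Finset.mem_erase.2 ⟨?_, h⟩
      rintro rfl
      exact h2'.1 hp

/-- The inner vertices form one of `arr 1 m` lists, and the marks are r of the at most m + 1
vertices before v. -/
theorem exists_finset_marked {V : Type*} [DecidableEq V] (v : V) (m : ℕ) :
    ∀ (S : Finset V) (x : V) (r : ℕ), S.card = m → x ≠ v → v ∉ S →
      ∃ T : Finset (List (V × Bool)), (∀ d, IsMarked v S x r d → d ∈ T) ∧
        T.card ≤ (m + 1).choose r * arr 1 m := by
  induction m with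
  | zero =>
    intro S x r hS hx _
    obtain rfl := Finset.card_eq_zero.1 hS
    obtain rfl | rfl | hr : r = 0 ∨ r = 1 ∨ 2 ≤ r := by omega
    · refine ⟨{[(x, false), (v, false)]}, fun d hd => ?_, by simp [arr]⟩
      obtain ⟨b, rfl, h⟩ | ⟨y, hy, -⟩ := hd.cases hx
      · cases b <;> simp at h ⊢
      · simp at hy
    · refine ⟨{[(x, true), (v, false)]}, fun d hd => ?_, by simp [arr]⟩
      obtain ⟨b, rfl, h⟩ | ⟨y, hy, -⟩ := hd.cases hx
      · cases b <;> simp_all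
      · simp at hy
    · refine ⟨∅, fun d hd => ?_, by simp⟩
      obtain ⟨b, rfl, h⟩ | ⟨y, hy, -⟩ := hd.cases hx
      · have := b.toNat_le; omega
      · simp at hy
  | succ m ih =>
    intro S x r hS hx hv
    have key : ∀ y r', ∃ T : Finset (List (V × Bool)), y ∈ S →
        (∀ d, IsMarked v (S.erase y) y r' d → d ∈ T) ∧
          T.card ≤ (m + 1).choose r' * arr 1 m := by
      intro y r'
      by_cases hy : y ∈ S
      · obtain ⟨T, hT⟩ := ih (S.erase y) y r' (by rw [Finset.card_erase_of_mem hy, hS]; rfl)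
          (fun h => hv (h ▸ hy)) (fun h => hv (Finset.mem_of_mem_erase h))
        exact ⟨T, fun _ => hT⟩
      · exact ⟨∅, fun h => absurd h hy⟩
    choose T hT using key
    rcases r with _ | r
    · refine ⟨{[(x, false), (v, false)]} ∪
        S.biUnion fun y => (T y 0).image (List.cons (x, false)), fun d hd => ?_, ?_⟩
      · rw [Finset.mem_union, Finset.mem_singleton, Finset.mem_biUnion]
        obtain ⟨b, rfl, h⟩ | ⟨y, hy, b, e, r', rfl, he, h⟩ := hd.cases hx
        · cases b <;> simp_all
        · cases b
          · obtain rfl : r' = 0 := by simpa using h.symm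
            exact Or.inr ⟨y, hy, Finset.mem_image_of_mem _ ((hT y 0 hy).1 e he)⟩
          · simp at h
      · refine (Finset.card_union_le _ _).trans ?_
        rw [Finset.card_singleton, arr_one_succ, Nat.choose_zero_right, one_mul]
        refine Nat.add_le_add_left (Finset.card_biUnion_le.trans ?_) 1
        rw [← hS, ← smul_eq_mul]
        refine Finset.sum_le_card_nsmul _ _ _ fun y hy => Finset.card_image_le.trans ?_
        simpa using (hT y 0 hy).2
    · refine ⟨(if r = 0 then {[(x, true), (v, false)]} else ∅) ∪
        S.biUnion fun y => (T y (r + 1)).image (List.cons (x, false)) ∪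
          (T y r).image (List.cons (x, true)), fun d hd => ?_, ?_⟩
      · rw [Finset.mem_union, Finset.mem_biUnion]
        obtain ⟨b, rfl, h⟩ | ⟨y, hy, b, e, r', rfl, he, h⟩ := hd.cases hx
        · cases b <;> simp_all
        · refine Or.inr ⟨y, hy, Finset.mem_union.2 ?_⟩
          cases b
          · obtain rfl : r' = r + 1 := by simpa using h.symm
            exact Or.inl (Finset.mem_image_of_mem _ ((hT y _ hy).1 e he))
          · obtain rfl : r' = r := by simpa using h.symm
            exact Or.inr (Finset.mem_image_of_mem _ ((hT y _ hy).1 e he))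
      · refine (Finset.card_union_le _ _).trans ?_
        rw [arr_one_succ, mul_add, mul_one]
        refine add_le_add ?_ (Finset.card_biUnion_le.trans ?_)
        · split_ifs with h
          · subst h; simp
          · simp
        · have : (m + 1 + 1).choose (r + 1) * ((m + 1) * arr 1 m) =
              S.card • ((m + 1 + 1).choose (r + 1) * arr 1 m) := by
            rw [hS, smul_eq_mul]; ring
          rw [this]
          refine Finset.sum_le_card_nsmul _ _ _ fun y hy => (Finset.card_union_le _ _).trans ?_
          -- Pascal's rule corresponds to whether `x` is marked.
          rw [Nat.choose_succ_succ (m + 1) r, add_mul, add_comm]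
          exact add_le_add (Finset.card_image_le.trans (hT y r hy).2)
            (Finset.card_image_le.trans (hT y (r + 1) hy).2)

/-- Only a covering by pairs `(d, g)` is needed, so overcounting is harmless. The range of r comes
from the 2r distinct pillars among n vertices. -/
theorem ncard_pathTails_le {V : Type*} [Fintype V] [DecidableEq V] {u v : V} (huv : u ≠ v) :
    (pathTails (bunkbed (SimpleGraph.completeGraph V)) (u, 0) (v, 0)).ncard ≤
      ∑ r ∈ Finset.range (Fintype.card V / 2 + 1),
        (Fintype.card V - 1).choose r * arr 1 (Fintype.card V - 2) *
          arr r (Fintype.card V - 2 * r) := by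
  set n := Fintype.card V with hn
  have hS : (((Finset.univ : Finset V).erase u).erase v).card = n - 2 := by
    rw [Finset.card_erase_of_mem (by simp [huv.symm]), Finset.card_erase_of_mem (by simp),
      Finset.card_univ]
    rfl
  have hn2 : 2 ≤ n := by
    have := Fintype.one_lt_card_iff.2 ⟨u, v, huv⟩
    omega
  have key : ∀ r, ∃ T : Finset (List (V × Bool)),
      (∀ d, IsMarked v ((Finset.univ.erase u).erase v) u r d → d ∈ T) ∧
        T.card ≤ (n - 2 + 1).choose r * arr 1 (n - 2) :=
    fun r => exists_finset_marked v (n - 2) _ u r hS huv (by simp)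
  choose T hT using key
  have key2 : ∀ (r : ℕ) (d : List (V × Bool)), ∃ U : Finset (List (List V)),
      (∀ g, g ∈ U ↔ IsArrangement r (Finset.univ \ (pillars d).toFinset) g) ∧
        U.card = arr r (Finset.univ \ (pillars d).toFinset).card :=
    fun r d => exists_finset_arrangements r _ _ rfl
  choose U hU using key2
  -- The filter makes the set left for the excursion interiors have exactly n - 2r elements.
  let P : ℕ → Finset (List (V × Bool)) := fun r =>
    (T r).filter fun d => (pillars d).Nodup ∧ (pillars d).length = 2 * r
  let W : Finset (List (V × Fin 2)) := (Finset.range (n / 2 + 1)).biUnion fun r =>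
    (P r).biUnion fun d => (U r d).image fun g => (weave d g).tail
  have hW : pathTails (bunkbed (SimpleGraph.completeGraph V)) (u, 0) (v, 0) ⊆ W := by
    rintro l ⟨h1, h2, h3⟩
    obtain ⟨b, d, g, hg, hd, h⟩ := (exists_weave_eq v l).1 u h1 h2 h3
    have hd' : ∀ p, ((u, b) :: d).getLast? = some p → p.2 = false := by
      intro p hp
      rw [hd] at hp
      rw [← Option.some.inj hp]
    set e := (u, b) :: d with he
    rw [← h, nodup_iff_level, level_zero_weave, (level_one_weave e g hd' hg).nodup_iff,
      List.nodup_append'] at h2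
    obtain ⟨h4, h5, h6, h7⟩ := h2
    have hlen := length_pillars e hd'
    have hle : (pillars e).length ≤ n := h5.length_le_card
    simp only [W, P, Finset.coe_biUnion, Set.mem_iUnion, Finset.mem_coe, Finset.mem_range,
      Finset.mem_filter, Finset.mem_image]
    refine ⟨marks e, by omega, e, ⟨(hT _).1 _ ⟨⟨b, d, rfl⟩, h4, ?_, hd, rfl⟩, h5, hlen⟩,
      g, ?_, by rw [h]; rfl⟩
    · intro p hp
      by_cases hpv : p = v
      · exact Or.inr hpv
      · refine Or.inl (Finset.mem_erase.2 ⟨hpv, Finset.mem_erase.2 ⟨?_, Finset.mem_univ _⟩⟩)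
        rintro hpu
        rw [he, List.map_cons, List.nodup_cons] at h4
        exact h4.1 (hpu ▸ hp)
    · rw [(hU _ _).1]
      refine ⟨hg, h6, fun x hx => ?_⟩
      simp only [Finset.mem_sdiff, Finset.mem_univ, true_and, List.mem_toFinset]
      exact fun hx' => h7 hx' hx
  refine (Set.ncard_le_ncard hW W.finite_toSet).trans ?_
  rw [Set.ncard_coe_finset]
  refine Finset.card_biUnion_le.trans (Finset.sum_le_sum fun r _ => ?_)
  refine Finset.card_biUnion_le.trans ?_
  have : ∀ d ∈ P r, ((U r d).image fun g => (weave d g).tail).card ≤ arr r (n - 2 * r) := by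
    intro d hd
    obtain ⟨-, h1, h2⟩ := Finset.mem_filter.1 hd
    refine Finset.card_image_le.trans_eq ?_
    rw [(hU r d).2, Finset.card_sdiff_of_subset (Finset.subset_univ _),
      List.toFinset_card_of_nodup h1, h2, Finset.card_univ]
  refine (Finset.sum_le_card_nsmul _ _ _ this).trans ?_
  rw [smul_eq_mul]
  refine Nat.mul_le_mul_right _ ((Finset.card_filter_le _ _).trans ?_)
  rw [show n - 1 = n - 2 + 1 by omega]
  exact (hT r).2

/-! ### Lower bound for walks from u_0 to v_1 -/

theorem exists_finset_nodup_lists {V : Type*} [DecidableEq V] (S : Finset V) :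
    ∃ T : Finset (List V), (∀ l, l ∈ T ↔ l.Nodup ∧ ∀ x ∈ l, x ∈ S) ∧ T.card = arr 1 S.card := by
  obtain ⟨T, hT, hc⟩ := exists_finset_arrangements 1 S.card S rfl
  refine ⟨T.image List.flatten, fun l => ?_, ?_⟩
  · rw [Finset.mem_image]
    constructor
    · rintro ⟨g, hg, rfl⟩
      exact ((hT g).1 hg).2
    · exact fun h => ⟨[l], (hT _).2 ⟨rfl, by simpa using h⟩, by simp⟩
  · rw [Finset.card_image_of_injOn, hc]
    intro g hg g' hg' h
    obtain ⟨a, rfl⟩ := List.length_eq_one_iff.1 ((hT g).1 hg).1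
    obtain ⟨b, rfl⟩ := List.length_eq_one_iff.1 ((hT g').1 hg').1
    simpa using h

theorem exists_finset_nodup_pairs {V : Type*} [DecidableEq V] (S : Finset V) :
    ∃ T : Finset (List V × List V),
      (∀ p, p ∈ T ↔ (p.1 ++ p.2).Nodup ∧ ∀ x ∈ p.1 ++ p.2, x ∈ S) ∧ T.card = arr 2 S.card := by
  obtain ⟨T, hT, hc⟩ := exists_finset_arrangements 2 S.card S rfl
  refine ⟨T.image fun g => (g.headI, g.tail.headI), fun l => ?_, ?_⟩
  · rw [Finset.mem_image]
    constructor
    · rintro ⟨g, hg, rfl⟩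
      obtain ⟨h1, h2⟩ := (hT g).1 hg
      obtain ⟨a, b, rfl⟩ := List.length_eq_two.1 h1
      simpa using h2
    · exact fun h => ⟨[l.1, l.2], (hT _).2 ⟨rfl, by simpa using h⟩, by simp⟩
  · rw [Finset.card_image_of_injOn, hc]
    intro g hg g' hg' h
    obtain ⟨a, b, rfl⟩ := List.length_eq_two.1 ((hT g).1 hg).1
    obtain ⟨a', b', rfl⟩ := List.length_eq_two.1 ((hT g').1 hg').1
    simpa using h

/-- The first entry at level `j` marks where the run at level `i` ends, so a walk can be parsed back
into its runs. -/
theorem map_append_cons_inj {V : Type*} {i j : Fin 2} (hij : j ≠ i) {y y' : V}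
    {R R' : List (V × Fin 2)} : ∀ {l l' : List V},
    l.map (·, i) ++ (y, j) :: R = l'.map (·, i) ++ (y', j) :: R' → l = l' ∧ y = y' ∧ R = R'
  | [], [], h => by simpa using h
  | [], x :: l', h => by simp [hij] at h
  | x :: l, [], h => by simp [hij.symm] at h
  | x :: l, x' :: l', h => by
    simp only [List.map_cons, List.cons_append, List.cons.injEq, Prod.mk.injEq, and_true] at h
    obtain ⟨rfl, h⟩ := h
    obtain ⟨rfl, h'⟩ := map_append_cons_inj hij h
    exact ⟨rfl, h'⟩

theorem isChain_run {V : Type*} (i : Fin 2) (l : List V) (hl : l.Nodup) :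
    (l.map (·, i)).IsChain (bunkbed (SimpleGraph.completeGraph V)).Adj := by
  rw [List.isChain_map]
  refine List.Pairwise.isChain (hl.imp fun h => ?_)
  rw [bunkbed_completeGraph_adj]
  exact Or.inl ⟨h, rfl⟩

theorem isChain_run_append {V : Type*} {i j : Fin 2} (hij : j ≠ i) (l : List V) (y : V)
    (R : List (V × Fin 2)) (hl : (l ++ [y]).Nodup)
    (hR : ((y, j) :: R).IsChain (bunkbed (SimpleGraph.completeGraph V)).Adj) :
    ((l ++ [y]).map (·, i) ++ (y, j) :: R).IsChain
      (bunkbed (SimpleGraph.completeGraph V)).Adj := by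
  refine List.isChain_append.2 ⟨isChain_run i _ hl, hR, ?_⟩
  intro p hp q hq
  obtain rfl : p = (y, i) := by simpa [eq_comm] using hp
  obtain rfl : q = (y, j) := by simpa [eq_comm] using hq
  rw [bunkbed_completeGraph_adj]
  exact Or.inr ⟨hij.symm, rfl⟩

theorem nodup_two_runs {V : Type*} {p x y z : V} {a b : List V} :
    (p :: (a ++ x :: y :: (b ++ [z]))).Nodup ↔ (p :: x :: y :: z :: (a ++ b)).Nodup := by
  refine List.Perm.nodup_iff (List.Perm.cons p (List.perm_middle.trans (List.Perm.cons x ?_)))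
  refine List.perm_middle.trans (List.Perm.cons y ?_)
  rw [← List.append_assoc]
  exact List.perm_append_singleton z (a ++ b)

/-- The vertices after the first one of a walk that ends at `v`, with one vertical edge, at `x`. -/
def oneCrossing {V : Type*} (v x : V) (a c : List V) : List (V × Fin 2) :=
  (a ++ [x]).map (·, 0) ++ (x, 1) :: (c ++ [v]).map (·, 1)

/-- The vertices after the first one of a walk that ends at `v`, with three vertical edges, at
`x`, `y` and `z`. -/
def threeCrossings {V : Type*} (v x y z : V) (a b c d : List V) : List (V × Fin 2) :=
  (a ++ [x]).map (·, 0) ++ (x, 1) :: ((c ++ [y]).map (·, 1) ++ (y, 0) ::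
    ((b ++ [z]).map (·, 0) ++ (z, 1) :: (d ++ [v]).map (·, 1)))

section crossings

variable {V : Type*} {u v x y z : V} {a b c d : List V}

theorem oneCrossing_mem (ha : (u :: (a ++ [x])).Nodup) (hc : (x :: (c ++ [v])).Nodup) :
    oneCrossing v x a c ∈ pathTails (bunkbed (SimpleGraph.completeGraph V)) (u, 0) (v, 1) := by
  refine ⟨?_, ?_, ?_⟩
  · exact isChain_run_append one_ne_zero (u :: a) x _ ha (isChain_run 1 _ hc)
  · rw [nodup_iff_level]
    simpa [oneCrossing, -List.nodup_cons] using ⟨ha, hc⟩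
  · simp [oneCrossing, List.getLast?_cons, List.getLast?_append]

theorem threeCrossings_mem (ha : (u :: (a ++ x :: y :: (b ++ [z]))).Nodup)
    (hc : (x :: (c ++ y :: z :: (d ++ [v]))).Nodup) :
    threeCrossings v x y z a b c d ∈
      pathTails (bunkbed (SimpleGraph.completeGraph V)) (u, 0) (v, 1) := by
  refine ⟨?_, ?_, ?_⟩
  · refine isChain_run_append one_ne_zero (u :: a) x _ (ha.sublist (by simp)) ?_
    refine isChain_run_append zero_ne_one (x :: c) y _ (hc.sublist (by simp)) ?_
    refine isChain_run_append one_ne_zero (y :: b) z _ (ha.sublist ?_) ?_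
    · exact List.Sublist.cons _ ((List.Sublist.cons _ (List.Sublist.refl _)).trans
        (List.sublist_append_right _ _))
    · refine isChain_run 1 (z :: (d ++ [v])) (hc.sublist ?_)
      exact List.Sublist.cons _ ((List.Sublist.cons _ (List.Sublist.refl _)).trans
        (List.sublist_append_right _ _))
  · rw [nodup_iff_level]
    simpa [threeCrossings, -List.nodup_cons] using ⟨ha, hc⟩
  · simp [threeCrossings, List.getLast?_cons, List.getLast?_append]

theorem oneCrossing_inj {x' : V} {a' c' : List V}
    (h : oneCrossing v x a c = oneCrossing v x' a' c') : x = x' ∧ a = a' ∧ c = c' := by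
  obtain ⟨h1, rfl, h2⟩ := map_append_cons_inj one_ne_zero h
  have h3 := List.map_injective_iff.2 (fun p q h => congrArg Prod.fst h) h2
  exact ⟨rfl, List.append_cancel_right h1, List.append_cancel_right h3⟩

theorem threeCrossings_inj {x' y' z' : V} {a' b' c' d' : List V}
    (h : threeCrossings v x y z a b c d = threeCrossings v x' y' z' a' b' c' d') :
    x = x' ∧ y = y' ∧ z = z' ∧ a = a' ∧ b = b' ∧ c = c' ∧ d = d' := by
  obtain ⟨h1, hx, h'⟩ := map_append_cons_inj one_ne_zero h
  obtain ⟨h2, hy, h''⟩ := map_append_cons_inj zero_ne_one h'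
  obtain ⟨h3, hz, h4⟩ := map_append_cons_inj one_ne_zero h''
  have h5 := List.map_injective_iff.2 (fun p q h => congrArg Prod.fst h) h4
  subst hx hy hz
  exact ⟨rfl, rfl, rfl, List.append_cancel_right h1, List.append_cancel_right h3,
    List.append_cancel_right h2, List.append_cancel_right h5⟩

theorem oneCrossing_ne_threeCrossings {x' : V} {a' c' : List V} :
    oneCrossing v x' a' c' ≠ threeCrossings v x y z a b c d := by
  intro h
  obtain ⟨-, -, h⟩ := map_append_cons_inj one_ne_zero h
  have : (y, (0 : Fin 2)) ∈ (c' ++ [v]).map (·, (1 : Fin 2)) := by rw [h]; simp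
  simp at this

end crossings

/-- Once the crossing vertices are fixed, the inner lists at the two levels are chosen
independently, which gives the squares. -/
theorem le_ncard_pathTails {V : Type*} [Fintype V] [DecidableEq V] {u v : V} (huv : u ≠ v) :
    (Fintype.card V - 2) * (arr 1 (Fintype.card V - 2) * arr 1 (Fintype.card V - 2)) +
      (Fintype.card V - 2) * ((Fintype.card V - 3) * ((Fintype.card V - 4) *
        (arr 2 (Fintype.card V - 4) * arr 2 (Fintype.card V - 4)))) ≤
      (pathTails (bunkbed (SimpleGraph.completeGraph V)) (u, 0) (v, 1)).ncard := by
  set n := Fintype.card V with hn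
  choose A hA hAc using fun S : Finset V => exists_finset_nodup_lists S
  choose B hB hBc using fun S : Finset V => exists_finset_nodup_pairs S
  let S : Finset V := (Finset.univ.erase u).erase v
  have hS : S.card = n - 2 := by
    rw [Finset.card_erase_of_mem (by simp [huv.symm]), Finset.card_erase_of_mem (by simp),
      Finset.card_univ]
    rfl
  -- The vertices v_0 and u_1 may be visited, so only u and x are excluded at level 0, and only x
  -- and v at level 1.
  let I : Finset (Σ _ : V, List V × List V) :=
    S.sigma fun x => A {u, x}ᶜ ×ˢ A {x, v}ᶜ
  let J : Finset (Σ _ : V, Σ _ : V, Σ _ : V, (List V × List V) × (List V × List V)) :=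
    S.sigma fun x => (S.erase x).sigma fun y => ((S.erase x).erase y).sigma fun z =>
      B {u, x, y, z}ᶜ ×ˢ B {x, y, z, v}ᶜ
  let f : (Σ _ : V, List V × List V) → List (V × Fin 2) :=
    fun i => oneCrossing v i.1 i.2.1 i.2.2
  let g : (Σ _ : V, Σ _ : V, Σ _ : V, (List V × List V) × (List V × List V)) →
      List (V × Fin 2) := fun i => threeCrossings v i.1 i.2.1 i.2.2.1 i.2.2.2.1.1 i.2.2.2.1.2
        i.2.2.2.2.1 i.2.2.2.2.2
  have hI : I.card = (n - 2) * (arr 1 (n - 2) * arr 1 (n - 2)) := by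
    rw [Finset.card_sigma, ← hS, ← smul_eq_mul, ← Finset.sum_const]
    refine Finset.sum_congr rfl fun x hx => ?_
    have hx' : x ≠ v ∧ x ≠ u := by simpa [S] using hx
    rw [Finset.card_product, hAc, hAc, Finset.card_compl, Finset.card_compl,
      Finset.card_pair hx'.2.symm, Finset.card_pair hx'.1, hS]
  have hJ : J.card = (n - 2) * ((n - 3) * ((n - 4) * (arr 2 (n - 4) * arr 2 (n - 4)))) := by
    rw [Finset.card_sigma, ← hS, ← smul_eq_mul, ← Finset.sum_const]
    refine Finset.sum_congr rfl fun x hx => ?_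
    have hx' : x ≠ v ∧ x ≠ u := by simpa [S] using hx
    have h3 : (S.erase x).card = n - 3 := by
      rw [Finset.card_erase_of_mem hx, hS]; omega
    rw [Finset.card_sigma, ← h3, ← smul_eq_mul, ← Finset.sum_const]
    refine Finset.sum_congr rfl fun y hy => ?_
    have hy' : y ≠ x ∧ y ≠ v ∧ y ≠ u := by simpa [S] using hy
    have h4 : ((S.erase x).erase y).card = n - 4 := by
      rw [Finset.card_erase_of_mem hy, h3]; omega
    rw [Finset.card_sigma]
    nth_rewrite 1 [← h4]
    rw [← smul_eq_mul (((S.erase x).erase y).card), ← Finset.sum_const]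
    refine Finset.sum_congr rfl fun z hz => ?_
    have hz' : z ≠ y ∧ z ≠ x ∧ z ≠ v ∧ z ≠ u := by simpa [S] using hz
    have c1 : ({u, x, y, z} : Finset V).card = 4 :=
      Finset.card_eq_four.2 ⟨u, x, y, z, by tauto, by tauto, by tauto, by tauto, by tauto,
        by tauto, rfl⟩
    have c2 : ({x, y, z, v} : Finset V).card = 4 :=
      Finset.card_eq_four.2 ⟨x, y, z, v, by tauto, by tauto, by tauto, by tauto, by tauto,
        by tauto, rfl⟩
    rw [Finset.card_product, hBc, hBc, Finset.card_compl, Finset.card_compl, c1, c2]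
  have hsub : ((I.image f ∪ J.image g : Finset _) : Set (List (V × Fin 2))) ⊆
      pathTails (bunkbed (SimpleGraph.completeGraph V)) (u, 0) (v, 1) := by
    intro l hl
    rw [Finset.mem_coe, Finset.mem_union, Finset.mem_image, Finset.mem_image] at hl
    obtain ⟨⟨x, a, c⟩, hi, rfl⟩ | ⟨⟨x, y, z, ⟨a, b⟩, c, d⟩, hi, rfl⟩ := hl
    · simp only [I, S, Finset.mem_sigma, Finset.mem_product, hA, Finset.mem_erase,
        Finset.mem_univ, and_true, Finset.mem_compl, Finset.mem_insert,
        Finset.mem_singleton] at hi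
      apply oneCrossing_mem
      · grind
      · grind
    · simp only [J, S, Finset.mem_sigma, Finset.mem_product, hB, Finset.mem_erase,
        Finset.mem_univ, and_true, Finset.mem_compl, Finset.mem_insert,
        Finset.mem_singleton] at hi
      obtain ⟨hx, hy, hz, ⟨hab, hab'⟩, hcd, hcd'⟩ := hi
      apply threeCrossings_mem
      · rw [nodup_two_runs]
        simp only [List.nodup_cons, List.mem_cons, not_or]
        exact ⟨⟨hx.2.symm, hy.2.2.symm, hz.2.2.2.symm, fun h => by simpa using hab' u h⟩,
          ⟨hy.1.symm, hz.2.1.symm, fun h => by simpa using hab' x h⟩,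
          ⟨hz.1.symm, fun h => by simpa using hab' y h⟩, fun h => by simpa using hab' z h, hab⟩
      · rw [nodup_two_runs]
        simp only [List.nodup_cons, List.mem_cons, not_or]
        exact ⟨⟨hy.1.symm, hz.2.1.symm, hx.1, fun h => by simpa using hcd' x h⟩,
          ⟨hz.1.symm, hy.2.1, fun h => by simpa using hcd' y h⟩,
          ⟨hz.2.2.1, fun h => by simpa using hcd' z h⟩, fun h => by simpa using hcd' v h, hcd⟩
  refine le_trans (le_of_eq ?_) (Set.ncard_le_ncard hsub (finite_pathTails _ _ _))
  rw [Set.ncard_coe_finset, Finset.card_union_of_disjoint, Finset.card_image_of_injective,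
    Finset.card_image_of_injective, hI, hJ]
  · rintro ⟨x, y, z, ⟨a, b⟩, c, d⟩ ⟨x', y', z', ⟨a', b'⟩, c', d'⟩ h
    obtain ⟨rfl, rfl, rfl, rfl, rfl, rfl, rfl⟩ := threeCrossings_inj h
    rfl
  · rintro ⟨x, a, c⟩ ⟨x', a', c'⟩ h
    obtain ⟨rfl, rfl, rfl⟩ := oneCrossing_inj h
    rfl
  · rw [Finset.disjoint_left]
    intro l hl hl'
    rw [Finset.mem_image] at hl hl'
    obtain ⟨i, -, rfl⟩ := hl
    obtain ⟨j, -, h⟩ := hl'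
    exact oneCrossing_ne_threeCrossings h.symm

/-! ### Comparison of the two bounds -/

-- The quotient `arr 1 k / k!` is the partial sum of 1/i! over i ≤ k, hence monotone.
open Nat in
theorem arr_one_mul_factorial_le {k m : ℕ} (h : k ≤ m) : arr 1 k * m ! ≤ arr 1 m * k ! := by
  induction m, h using Nat.le_induction with
  | base => exact le_rfl
  | succ m _ ih =>
    rw [arr_one_succ, Nat.factorial_succ]
    nlinarith [Nat.mul_le_mul_left (m + 1) ih, Nat.zero_le (k !)]

-- With k = n - 2(s+1), one has C(n-1, s+1)·C(k+s, s)·k!/(n-2)! = (n-1)/((s+1)! s!); the two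
-- preceding estimates for `arr` supply the second binomial and the quotient of factorials.
open Nat in
theorem choose_mul_arr_mul_factorial_le {n s : ℕ} (h : 2 * (s + 1) ≤ n) :
    (n - 1).choose (s + 1) * arr 1 (n - 2) * arr (s + 1) (n - 2 * (s + 1)) *
      ((s + 1)! * s !) ≤ (n - 1) * arr 1 (n - 2) ^ 2 := by
  obtain ⟨k, rfl⟩ := Nat.exists_eq_add_of_le' h
  rw [show k + 2 * (s + 1) - 1 = k + s + (s + 1) by omega,
    show k + 2 * (s + 1) - 2 = k + 2 * s by omega, Nat.add_sub_cancel]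
  set F := arr 1 (k + 2 * s)
  have h1 := arr_succ_le_choose_mul s k
  have h2 : arr 1 k * (k + 2 * s)! ≤ F * k ! := arr_one_mul_factorial_le (by omega)
  have h3 : (k + s + (s + 1)).choose (s + 1) * (k + s)! * (s + 1)! = (k + s + (s + 1))! :=
    Nat.add_choose_mul_factorial_mul_factorial (k + s) (s + 1)
  have h4 : (k + s).choose s * k ! * s ! = (k + s)! :=
    Nat.add_choose_mul_factorial_mul_factorial k s
  have h5 : (k + s + (s + 1))! = (k + s + (s + 1)) * (k + 2 * s)! := by
    rw [show k + s + (s + 1) = k + 2 * s + 1 by ring, Nat.factorial_succ]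
  refine Nat.le_of_mul_le_mul_right ?_ (Nat.factorial_pos (k + 2 * s))
  calc (k + s + (s + 1)).choose (s + 1) * F * arr (s + 1) k * ((s + 1)! * s !) * (k + 2 * s)!
      ≤ (k + s + (s + 1)).choose (s + 1) * F * ((k + s).choose s * arr 1 k) *
          ((s + 1)! * s !) * (k + 2 * s)! := by gcongr
    _ = (k + s + (s + 1)).choose (s + 1) * F * (k + s).choose s * ((s + 1)! * s !) *
          (arr 1 k * (k + 2 * s)!) := by ring
    _ ≤ (k + s + (s + 1)).choose (s + 1) * F * (k + s).choose s * ((s + 1)! * s !) *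
          (F * k !) := by gcongr
    _ = (k + s + (s + 1)).choose (s + 1) * ((k + s).choose s * k ! * s !) * (s + 1)! * F ^ 2 := by
        ring
    _ = (k + s + (s + 1)) * F ^ 2 * (k + 2 * s)! := by
        rw [h4, h3, h5]; ring

-- From s = 2 on, the terms are dominated by the geometric ones 1/(3·2^s). The subtracted tail lets
-- the induction close, with equality at R = 2.
open Nat in
theorem sum_inv_factorial_mul_factorial_le (R : ℕ) :
    ∑ s ∈ Finset.range R, 1 / (((s + 1)! * s ! : ℕ) : ℝ) ≤ 5 / 3 - 2 / 3 / 2 ^ R := by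
  rcases R with _ | _ | R
  · norm_num
  · norm_num
  · induction R with
    | zero => norm_num [Finset.sum_range_succ, Nat.factorial]
    | succ R ih =>
      rw [Finset.sum_range_succ]
      have h : ∀ R : ℕ, 3 * 2 ^ (R + 1 + 1) ≤ (R + 1 + 1 + 1)! * (R + 1 + 1)! := by
        intro R
        induction R with
        | zero => decide
        | succ R ih =>
          rw [Nat.factorial_succ (R + 1 + 1 + 1), Nat.factorial_succ (R + 1 + 1), pow_succ]
          rw [Nat.factorial_succ (R + 1 + 1)] at ih
          have : 2 ≤ (R + 1 + 1 + 1 + 1) * (R + 1 + 1 + 1) := by nlinarith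
          nlinarith [Nat.mul_le_mul ih this]
      have h1 : 1 / (((R + 1 + 1 + 1)! * (R + 1 + 1)! : ℕ) : ℝ) ≤ 1 / (3 * 2 ^ (R + 1 + 1)) := by
        apply one_div_le_one_div_of_le (by positivity)
        exact_mod_cast h R
      have h2 : (2 : ℝ) / 3 / 2 ^ (R + 1 + 1) =
          2 / 3 / 2 ^ (R + 1 + 1 + 1) + 1 / (3 * 2 ^ (R + 1 + 1)) := by
        field_simp; ring
      linarith

theorem sum_choose_mul_arr_le (n : ℕ) :
    ((∑ r ∈ Finset.range (n / 2 + 1),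
      (n - 1).choose r * arr 1 (n - 2) * arr r (n - 2 * r) : ℕ) : ℝ) ≤
      arr 1 (n - 2) + 5 / 3 * ((n - 1 : ℕ) * (arr 1 (n - 2) : ℝ) ^ 2) := by
  rw [Finset.sum_range_succ', Nat.cast_add, add_comm]
  have h0 : (n - 1).choose 0 * arr 1 (n - 2) * arr 0 (n - 2 * 0) = arr 1 (n - 2) := by
    simp [arr]
  rw [h0, Nat.cast_sum]
  refine add_le_add le_rfl ?_
  calc _ ≤ ∑ s ∈ Finset.range (n / 2), 1 / (((s + 1).factorial * s.factorial : ℕ) : ℝ) *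
        ((n - 1 : ℕ) * (arr 1 (n - 2) : ℝ) ^ 2) := by
        refine Finset.sum_le_sum fun s hs => ?_
        rw [one_div_mul_eq_div, le_div_iff₀ (by positivity)]
        have := choose_mul_arr_mul_factorial_le (n := n) (s := s)
          (by rw [Finset.mem_range] at hs; omega)
        exact_mod_cast this
    _ ≤ _ := by
        rw [← Finset.sum_mul]
        refine mul_le_mul_of_nonneg_right ?_ (by positivity)
        refine (sum_inv_factorial_mul_factorial_le _).trans ?_
        have : (0 : ℝ) ≤ 2 / 3 / 2 ^ (n / 2) := by positivity
        linarith

theorem ncard_selfAvoidingWalks_lt {V : Type*} [Fintype V] {u v : V} (huv : u ≠ v)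
    (hV : 104 ≤ Fintype.card V) :
    (selfAvoidingWalks (bunkbed (SimpleGraph.completeGraph V)) (u, 0) (v, 0)).ncard <
      (selfAvoidingWalks (bunkbed (SimpleGraph.completeGraph V)) (u, 0) (v, 1)).ncard := by
  classical
  rw [ncard_selfAvoidingWalks, ncard_selfAvoidingWalks]
  have hle := ncard_pathTails_le huv
  have hge := le_ncard_pathTails huv
  have hsum := sum_choose_mul_arr_le (Fintype.card V)
  refine lt_of_le_of_lt hle (lt_of_lt_of_le ?_ hge)
  rw [← Nat.cast_lt (α := ℝ)]
  refine hsum.trans_lt ?_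
  -- Writing n = t + 104 removes truncated subtraction and gives the polynomial behind `h5` only
  -- positive coefficients in t; any sufficiently large shift would do.
  obtain ⟨t, ht⟩ := Nat.exists_eq_add_of_le' hV
  rw [ht, show t + 104 - 2 = t + 100 + 1 + 1 by omega, show t + 104 - 3 = t + 101 by omega,
    show t + 104 - 4 = t + 100 by omega, show t + 104 - 1 = t + 103 by omega, arr_two]
  set F := arr 1 (t + 100 + 1 + 1) with hF
  rw [arr_one_succ, arr_one_succ] at hF
  set k := arr 1 (t + 100)
  have hk : 1 ≤ k := by
    have := arr_one_mul_factorial_le (Nat.zero_le (t + 100))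
    rw [arr_one_zero, Nat.factorial_zero, one_mul, mul_one] at this
    exact (Nat.factorial_pos _).trans_le this
  have hk' : (1 : ℝ) ≤ k := by exact_mod_cast hk
  have ht0 : (0 : ℝ) ≤ t := Nat.cast_nonneg t
  have hF' : (F : ℝ) = 1 + (t + 102) * (1 + (t + 101) * k) := by
    rw [hF]; push_cast; ring
  have h1 : (1 : ℝ) ≤ F := by
    rw [hF']
    have : (0 : ℝ) ≤ (t + 102) * (1 + (t + 101) * k) := by positivity
    linarith
  have h2 : (F : ℝ) ≤ ((t + 102) * (t + 101) + (t + 103)) * k := by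
    rw [hF']; nlinarith
  have h3 : (F : ℝ) ^ 2 ≤ (((t + 102) * (t + 101) + (t + 103)) * k) ^ 2 :=
    pow_le_pow_left₀ (by linarith) h2 2
  have h4 : (F : ℝ) ≤ F ^ 2 := by nlinarith
  -- The first factor is 1 + (5/3)(n-1) - (n-2): the upper bound, with F ≤ F² for its r = 0 term,
  -- minus the walks with one vertical edge. It remains to beat it by the walks with three.
  have h5 : (2 / 3 * (t + 100) + 4 : ℝ) * (((t + 102) * (t + 101) + (t + 103)) * k) ^ 2 <
      (t + 102) * ((t + 101) * ((t + 100) * (((t + 100) * k) * ((t + 100) * k)))) := by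
    rw [← sub_pos]
    have : (0 : ℝ) < ((t + 102) * (t + 101) * (t + 100) ^ 3 -
        (2 / 3 * (t + 100) + 4) * ((t + 102) * (t + 101) + (t + 103)) ^ 2) * k ^ 2 := by
      refine mul_pos ?_ (by positivity)
      ring_nf
      positivity
    linarith
  have h6 : ((t + 100) * k : ℝ) * ((t + 100) * k) ≤
      ((t + 100) * k + 1) * ((t + 100) * k + 1) := by
    have : (0 : ℝ) ≤ (t + 100) * k := by positivity
    nlinarith
  have h7 : (t + 102 : ℝ) * ((t + 101) * ((t + 100) * (((t + 100) * k) * ((t + 100) * k)))) ≤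
      (t + 102) * ((t + 101) * ((t + 100) * (((t + 100) * k + 1) * ((t + 100) * k + 1)))) := by
    gcongr
  have h8 := mul_le_mul_of_nonneg_left h3 (show (0 : ℝ) ≤ 2 / 3 * (t + 100) + 4 by positivity)
  push_cast
  nlinarith

theorem theorem1p7 :
    (∀ u v : Fin 2, u ≠ v →
      (selfAvoidingWalks (bunkbed (SimpleGraph.completeGraph (Fin 2))) (u, 0) (v, 0)).ncard =
        (selfAvoidingWalks (bunkbed (SimpleGraph.completeGraph (Fin 2))) (u, 0) (v, 1)).ncard) ∧
    (∀ n : ℕ, n = 3 ∨ n = 4 ∨ n = 5 → ∀ u v : Fin n, u ≠ v →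
      (selfAvoidingWalks (bunkbed (SimpleGraph.completeGraph (Fin n))) (u, 0) (v, 0)).ncard <
        (selfAvoidingWalks (bunkbed (SimpleGraph.completeGraph (Fin n))) (u, 0) (v, 1)).ncard) ∧
    (∃ N : ℕ, ∀ n : ℕ, N ≤ n → ∀ u v : Fin n, u ≠ v →
      (selfAvoidingWalks (bunkbed (SimpleGraph.completeGraph (Fin n))) (u, 0) (v, 0)).ncard <
        (selfAvoidingWalks (bunkbed (SimpleGraph.completeGraph (Fin n))) (u, 0) (v, 1)).ncard) := by
  refine ⟨fun u v huv => ?_, ?_, 104, fun n hn u v huv => ?_⟩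
  · rw [ncard_selfAvoidingWalks_eq_bunkbedCount, ncard_selfAvoidingWalks_eq_bunkbedCount]
    exact bunkbedCount_two u v huv
  · rintro n (rfl | rfl | rfl) u v huv <;>
      rw [ncard_selfAvoidingWalks_eq_bunkbedCount, ncard_selfAvoidingWalks_eq_bunkbedCount]
    · exact bunkbedCount_three u v huv
    · exact bunkbedCount_four u v huv
    · exact bunkbedCount_five u v huv
  · exact ncard_selfAvoidingWalks_lt huv (by rwa [Fintype.card_fin])
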